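/- Conventions. Directed sets are nonempty. A dcpo is a poset in which every directed subset has a supremum; it is called well-filtered if its Scott topology is well-filtered, i.e. whenever $\mathcal C$ is a nonempty filtered family of Scott compact saturated (= upper) subsets and $U$ is Scott open with $\bigcap\mathcal C\subseteq U$, some $K\in\mathcal C$ satisfies $K\subseteq U$. Let $\mathbf{WF}$ be the category of well-filtered dcpos and Scott continuous maps. For $L$ in $\mathbf{WF}$ let $\mathcal H(L)$ be the set of all Scott closed subsets of $L$ ordered by inclusion, and let $\mathcal Q(L)$ be the set of all nonempty Scott compact saturated subsets of $L$ ordered by reverse inclusion. On morphisms, $\mathcal H(f)(A)=\mathrm{cl}(f(A))$ and $\mathcal Q(f)(K)={\uparrow}f(K)$. The monad $\mathcal H$ has unit $\eta_L(x)={\downarrow}x$ and multiplication $\mu_L(\mathcal A)=\bigcup\mathcal A$; the monad $\mathcal Q$ has unit $\theta_L(x)={\uparrow}x$ and multiplication $\iota_L(\mathcal K)=\bigcup\mathcal K$. The distributive law $\phi:\mathcal{HQ}\to\mathcal{QH}$ is $$\phi_L(\mathcal A)=\{A\in\mathcal H(L): A\cap K\neq\emptyset \text{ for all } K\in\mathcal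 A\}.$$ The composite monad $\mathcal{QH}$ has unit $\gamma_L=\theta_{\mathcal H(L)}\circ\eta_L$ and multiplication $\rho_L=\mathcal Q(\mu_L)\circ\iota_{\mathcal H\mathcal H(L)}\circ\mathcal Q(\phi_{\mathcal H(L)})$. A $\mathcal{QH}$-algebra is a pair $(L,\alpha)$ with $L$ in $\mathbf{WF}$ and $\alpha:\mathcal{QH}(L)\to L$ Scott continuous such that $\alpha\circ\gamma_L=\mathrm{id}_L$ and $\alpha\circ\rho_L=\alpha\circ\mathcal{QH}(\alpha)$. Proposition. Let $(L,\alpha)$ be a $\mathcal{QH}$-algebra such that $\phi_L:\mathcal{HQ}(L)\to\mathcal{QH}(L)$ is an isomorphism (it has a Scott continuous two-sided inverse). Then $L$, with its given order, is a frame, i.e. a complete lattice in which $x\wedge\bigvee S=\bigvee_{s\in S}(x\wedge s)$ for all $x\in L$ and $S\subseteq L$ (equivalently, a meet-continuous complete lattice satisfying finite distributivity). -/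

import Mathlib

open Set Topology

namespace PowerDomain

universe u v w

section ScottTopology

variable {P : Type u} [PartialOrder P] {Q : Type v} [PartialOrder Q]

/-- `C` is closed in the Scott topology of `P`. -/
def IsScottClosed (C : Set P) : Prop := IsClosed[Topology.scott P univ] C

/-- `U` is open in the Scott topology of `P`. -/
def IsScottOpen (U : Set P) : Prop := IsOpen[Topology.scott P univ] U

/-- `K` is compact in the Scott topology of `P`. -/
def IsScottCompact (K : Set P) : Prop := @IsCompact P (Topology.scott P univ) K

theorem isScottClosed_iff {C : Set P} :
    IsScottClosed C ↔ IsLowerSet C ∧ DirSupClosed C := by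
  let _ : TopologicalSpace P := Topology.scott P univ
  have _ : IsScott P univ := ⟨rfl⟩
  exact IsScott.isClosed_iff_isLowerSet_and_dirSupClosed

theorem isScottOpen_compl {C : Set P} : IsScottOpen Cᶜ ↔ IsScottClosed C := by
  let _ : TopologicalSpace P := Topology.scott P univ
  exact isOpen_compl_iff

theorem isScottClosed_compl {U : Set P} : IsScottClosed Uᶜ ↔ IsScottOpen U := by
  let _ : TopologicalSpace P := Topology.scott P univ
  exact isClosed_compl_iff

theorem isScottClosed_sInter {S : Set (Set P)} (h : ∀ C ∈ S, IsScottClosed C) :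
    IsScottClosed (⋂₀ S) := by
  let _ : TopologicalSpace P := Topology.scott P univ
  exact isClosed_sInter h

theorem IsScottClosed.inter {C D : Set P} (hC : IsScottClosed C) (hD : IsScottClosed D) :
    IsScottClosed (C ∩ D) := by
  let _ : TopologicalSpace P := Topology.scott P univ
  exact IsClosed.inter hC hD

theorem isScottClosed_Iic (x : P) : IsScottClosed (Iic x) :=
  isScottClosed_iff.2 ⟨isLowerSet_Iic x, dirSupClosed_Iic x⟩

theorem IsScottClosed.preimage {f : P → Q} (hf : ScottContinuous f) {C : Set Q}
    (hC : IsScottClosed C) : IsScottClosed (f ⁻¹' C) := by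
  rw [isScottClosed_iff] at hC ⊢
  refine ⟨fun x y hyx hx => hC.1 (hf.monotone hyx) hx, fun d hd hne hdir a ha => ?_⟩
  exact hC.2 (image_subset_iff.2 hd) (hne.image f)
    (directedOn_image.2 (hdir.mono fun _ _ h => hf.monotone h)) (hf hne hdir ha)

/-- Compactness in terms of filtered families of closed sets. -/
theorem isScottCompact_iff {K : Set P} :
    IsScottCompact K ↔ ∀ S : Set (Set P), S.Nonempty → DirectedOn (· ⊇ ·) S →
      (∀ C ∈ S, IsScottClosed C) → (∀ C ∈ S, (K ∩ C).Nonempty) → (K ∩ ⋂₀ S).Nonempty := by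
  let _ : TopologicalSpace P := Topology.scott P univ
  constructor
  · intro hK S hne hdir hcl hmeet
    have _ : Nonempty S := hne.to_subtype
    by_contra hcon
    rw [not_nonempty_iff_eq_empty, sInter_eq_iInter] at hcon
    obtain ⟨C, hC⟩ := IsCompact.elim_directed_family_closed (s := K) hK
      (fun C : S => (C : Set P)) (fun C => hcl C C.2) hcon hdir.directed_val
    exact (hmeet C C.2).ne_empty hC
  · intro h
    refine isCompact_of_finite_subcover fun {ι} U hU hKU => ?_
    by_contra hcon
    push Not at hcon
    obtain ⟨x, hxK, hx⟩ := h (range fun t : Finset ι => (⋃ i ∈ t, U i)ᶜ) (range_nonempty _) (by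
        rintro _ ⟨s, rfl⟩ _ ⟨t, rfl⟩
        classical
        refine ⟨_, ⟨s ∪ t, rfl⟩, ?_, ?_⟩
        · exact compl_subset_compl.2 (biUnion_subset_biUnion_left fun i hi => by
            exact Finset.mem_union_left _ hi)
        · exact compl_subset_compl.2 (biUnion_subset_biUnion_left fun i hi => by
            exact Finset.mem_union_right _ hi))
      (by
        rintro _ ⟨t, rfl⟩
        exact (isOpen_biUnion fun i _ => hU i).isClosed_compl)
      (by
        rintro _ ⟨t, rfl⟩
        obtain ⟨x, hx, hx'⟩ := not_subset.1 (hcon t)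
        exact ⟨x, hx, hx'⟩)
    obtain ⟨i, hi⟩ := mem_iUnion.1 (hKU hxK)
    have := hx _ ⟨{i}, rfl⟩
    simp at this
    exact this hi

/-- The saturation of a continuous image of a compact set is compact. -/
theorem IsScottCompact.upperImage {f : P → Q} (hf : ScottContinuous f) {K : Set P}
    (hK : IsScottCompact K) : IsScottCompact {y | ∃ x ∈ K, f x ≤ y} := by
  rw [isScottCompact_iff] at hK ⊢
  intro S hne hdir hcl hmeet
  obtain ⟨x, hxK, hx⟩ := hK ((fun C => f ⁻¹' C) '' S) (hne.image _)
    (by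
      rintro _ ⟨C, hC, rfl⟩ _ ⟨D, hD, rfl⟩
      obtain ⟨E, hE, h1, h2⟩ := hdir C hC D hD
      exact ⟨_, ⟨E, hE, rfl⟩, preimage_mono h1, preimage_mono h2⟩)
    (by rintro _ ⟨C, hC, rfl⟩; exact (hcl C hC).preimage hf)
    (by
      rintro _ ⟨C, hC, rfl⟩
      obtain ⟨y, ⟨x, hx, hxy⟩, hy⟩ := hmeet C hC
      exact ⟨x, hx, (isScottClosed_iff.1 (hcl C hC)).1 hxy hy⟩)
  exact ⟨f x, ⟨x, hxK, le_rfl⟩, fun C hC => hx _ ⟨C, hC, rfl⟩⟩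

theorem isScottCompact_Ici (x : P) : IsScottCompact (Ici x) := by
  rw [isScottCompact_iff]
  intro S _ _ hcl hmeet
  refine ⟨x, le_rfl, fun C hC => ?_⟩
  obtain ⟨y, hy, hyC⟩ := hmeet C hC
  exact (isScottClosed_iff.1 (hcl C hC)).1 hy hyC

theorem IsScottCompact.inter_closed {K C : Set P} (hK : IsScottCompact K) (hC : IsScottClosed C) :
    IsScottCompact (K ∩ C) := by
  let _ : TopologicalSpace P := Topology.scott P univ
  exact IsCompact.inter_right hK hC

/-- A minimal closed set among those that meet every member of a family of compact sets. -/
theorem exists_minimal_closed {S : Set (Set P)} (hS : ∀ K ∈ S, IsScottCompact K) {C₀ : Set P}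
    (hC₀ : IsScottClosed C₀) (hmeet : ∀ K ∈ S, (K ∩ C₀).Nonempty) :
    ∃ C ⊆ C₀, IsScottClosed C ∧ (∀ K ∈ S, (K ∩ C).Nonempty) ∧
      ∀ D ⊆ C, IsScottClosed D → (∀ K ∈ S, (K ∩ D).Nonempty) → C ⊆ D := by
  obtain ⟨C, hCC₀, hmin⟩ := zorn_superset_nonempty
    {C : Set P | IsScottClosed C ∧ ∀ K ∈ S, (K ∩ C).Nonempty} (by
      intro c hc hchain hne
      refine ⟨⋂₀ c, ⟨isScottClosed_sInter fun C hC => (hc hC).1, fun K hK => ?_⟩,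
        fun s hs => sInter_subset_of_mem hs⟩
      refine isScottCompact_iff.1 (hS K hK) c hne ?_ (fun C hC => (hc hC).1)
        (fun C hC => (hc hC).2 K hK)
      intro A hA B hB
      rcases hchain.total hA hB with h | h
      · exact ⟨A, hA, Subset.rfl, h⟩
      · exact ⟨B, hB, h, Subset.rfl⟩) C₀ ⟨hC₀, hmeet⟩
  exact ⟨C, hCC₀, hmin.prop.1, hmin.prop.2, fun D hD h1 h2 => hmin.le_of_le ⟨h1, h2⟩ hD⟩

end ScottTopology

/-- A well-filtered dcpo: every nonempty directed subset has a supremum, and the Scott topology is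
well-filtered. Since the specialization order of the Scott topology is the given order, the
saturated sets are the upper sets. -/
class WellFilteredDcpo (P : Type u) [PartialOrder P] : Prop where
  exists_isLUB : ∀ D : Set P, D.Nonempty → DirectedOn (· ≤ ·) D → ∃ a, IsLUB D a
  wellFiltered : ∀ S : Set (Set P), S.Nonempty → DirectedOn (· ⊇ ·) S →
    (∀ K ∈ S, IsScottCompact K ∧ IsUpperSet K) →
    ∀ U : Set P, IsScottOpen U → ⋂₀ S ⊆ U → ∃ K ∈ S, K ⊆ U

section CompleteLattice

variable {M : Type u} [CompleteLattice M]

theorem isScottClosed_sup {C : Set M} (hC : IsScottClosed C) (x : M) :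
    IsScottClosed {k | k ⊔ x ∈ C} := by
  rw [isScottClosed_iff] at hC ⊢
  refine ⟨fun a b hba ha => hC.1 (sup_le_sup_right hba x) ha, fun d hd hne hdir a ha => ?_⟩
  refine hC.2 (d := (fun k => k ⊔ x) '' d) (image_subset_iff.2 hd) (hne.image _)
    (directedOn_image.2 (hdir.mono fun _ _ h => sup_le_sup_right h x)) ⟨?_, ?_⟩
  · rintro _ ⟨k, hk, rfl⟩
    exact sup_le_sup_right (ha.1 hk) x
  · intro b hb
    obtain ⟨k₀, hk₀⟩ := hne
    exact sup_le (ha.2 fun k hk => le_sup_left.trans (hb ⟨k, hk, rfl⟩))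
      (le_sup_right.trans (hb ⟨k₀, hk₀, rfl⟩))

theorem isScottClosed_exists_sup {C K : Set M} (hC : IsScottClosed C) (hK : IsScottCompact K) :
    IsScottClosed {x | ∃ k ∈ K, k ⊔ x ∈ C} := by
  rw [isScottClosed_iff]
  refine ⟨fun a b hba ⟨k, hk, h⟩ =>
    ⟨k, hk, (isScottClosed_iff.1 hC).1 (sup_le_sup_left hba k) h⟩, fun d hd hne hdir a ha => ?_⟩
  obtain ⟨k, hkK, hk⟩ := isScottCompact_iff.1 hK ((fun x => {k | k ⊔ x ∈ C}) '' d) (hne.image _)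
    (by
      rintro _ ⟨x, hx, rfl⟩ _ ⟨y, hy, rfl⟩
      obtain ⟨z, hz, hxz, hyz⟩ := hdir x hx y hy
      exact ⟨_, ⟨z, hz, rfl⟩,
        fun k hk => (isScottClosed_iff.1 hC).1 (sup_le_sup_left hxz k) hk,
        fun k hk => (isScottClosed_iff.1 hC).1 (sup_le_sup_left hyz k) hk⟩)
    (by rintro _ ⟨x, -, rfl⟩; exact isScottClosed_sup hC x)
    (by rintro _ ⟨x, hx, rfl⟩; exact hd hx)
  refine ⟨k, hkK, ?_⟩
  have h := (isScottClosed_iff.1 (isScottClosed_sup hC k)).2 (d := d)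
    (fun x hx => by
      have : k ⊔ x ∈ C := hk _ ⟨x, hx, rfl⟩
      rwa [sup_comm] at this) hne hdir ha
  rw [sup_comm]
  exact h

/-- A complete lattice is a well-filtered dcpo. -/
instance : WellFilteredDcpo M where
  exists_isLUB D _ _ := ⟨sSup D, isLUB_sSup D⟩
  wellFiltered S hne hdir hS U hU hSU := by
    by_contra hcon
    push Not at hcon
    obtain ⟨C, hCU, hCcl, hCmeet, hCmin⟩ := exists_minimal_closed (fun K hK => (hS K hK).1)
      (isScottClosed_compl.2 hU) (fun K hK => not_subset.1 (hcon K hK))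
    have h1 : ∀ x ∈ C, ∀ K ∈ S, ∃ k ∈ K, k ⊔ x ∈ C := by
      intro x hx K hK
      refine (hCmin (C ∩ {x | ∃ k ∈ K, k ⊔ x ∈ C}) inter_subset_left
        (hCcl.inter (isScottClosed_exists_sup hCcl (hS K hK).1)) (fun K' hK' => ?_) hx).2
      obtain ⟨K'', hK'', ha, hb⟩ := hdir K hK K' hK'
      obtain ⟨y, hy, hyC⟩ := hCmeet K'' hK''
      exact ⟨y, hb hy, hyC, y, ha hy, by rwa [sup_idem]⟩
    have h2 : ∀ x ∈ C, ∀ y ∈ C, y ⊔ x ∈ C := by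
      intro x hx y hy
      refine (hCmin (C ∩ {y | y ⊔ x ∈ C}) inter_subset_left
        (hCcl.inter (isScottClosed_sup hCcl x)) (fun K hK => ?_) hy).2
      obtain ⟨k, hk, hkx⟩ := h1 x hx K hK
      exact ⟨k, hk, (isScottClosed_iff.1 hCcl).1 le_sup_left hkx, hkx⟩
    have hCne : C.Nonempty := by
      obtain ⟨K, hK⟩ := hne
      exact (hCmeet K hK).mono inter_subset_right
    have hsup : sSup C ∈ C := (isScottClosed_iff.1 hCcl).2 Subset.rfl hCne
      (fun x hx y hy => ⟨y ⊔ x, h2 x hx y hy, le_sup_right, le_sup_left⟩) (isLUB_sSup C)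
    refine hCU hsup (hSU fun K hK => ?_)
    obtain ⟨k, hk, hkC⟩ := hCmeet K hK
    exact (hS K hK).2 (le_sSup hkC) hk

theorem isScottCompact_inter {K₁ K₂ : Set M} (h₁ : IsScottCompact K₁) (h₂ : IsScottCompact K₂)
    (u₁ : IsUpperSet K₁) (u₂ : IsUpperSet K₂) : IsScottCompact (K₁ ∩ K₂) := by
  rw [isScottCompact_iff]
  intro S hne hdir hcl hmeet
  obtain ⟨x, hx₂, hx⟩ := isScottCompact_iff.1 h₂ ((fun C => {x | ∃ k ∈ K₁, k ⊔ x ∈ C}) '' S)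
    (hne.image _)
    (by
      rintro _ ⟨C, hC, rfl⟩ _ ⟨D, hD, rfl⟩
      obtain ⟨E, hE, h1, h2⟩ := hdir C hC D hD
      exact ⟨_, ⟨E, hE, rfl⟩, fun x ⟨k, hk, h⟩ => ⟨k, hk, h1 h⟩,
        fun x ⟨k, hk, h⟩ => ⟨k, hk, h2 h⟩⟩)
    (by rintro _ ⟨C, hC, rfl⟩; exact isScottClosed_exists_sup (hcl C hC) h₁)
    (by
      rintro _ ⟨C, hC, rfl⟩
      obtain ⟨y, ⟨hy₁, hy₂⟩, hyC⟩ := hmeet C hC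
      exact ⟨y, hy₂, y, hy₁, by rwa [sup_idem]⟩)
  obtain ⟨k, hk₁, hk⟩ := isScottCompact_iff.1 h₁ ((fun C => {k | k ⊔ x ∈ C}) '' S)
    (hne.image _)
    (by
      rintro _ ⟨C, hC, rfl⟩ _ ⟨D, hD, rfl⟩
      obtain ⟨E, hE, h1, h2⟩ := hdir C hC D hD
      exact ⟨_, ⟨E, hE, rfl⟩, fun x h => h1 h, fun x h => h2 h⟩)
    (by rintro _ ⟨C, hC, rfl⟩; exact isScottClosed_sup (hcl C hC) x)
    (by rintro _ ⟨C, hC, rfl⟩; exact hx _ ⟨C, hC, rfl⟩)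
  exact ⟨k ⊔ x, ⟨u₁ le_sup_left hk₁, u₂ le_sup_right hx₂⟩, fun C hC => hk _ ⟨C, hC, rfl⟩⟩

end CompleteLattice

/-- In a well-filtered dcpo, a filtered intersection of compact saturated sets is compact. -/
theorem isScottCompact_sInter_of_directed {P : Type u} [PartialOrder P] [WellFilteredDcpo P]
    {S : Set (Set P)} (hne : S.Nonempty) (hdir : DirectedOn (· ⊇ ·) S)
    (hS : ∀ K ∈ S, IsScottCompact K ∧ IsUpperSet K) : IsScottCompact (⋂₀ S) := by
  rw [isScottCompact_iff]
  intro T hTne hTdir hTcl hmeet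
  by_contra hcon
  obtain ⟨K, hK, hKT⟩ := WellFilteredDcpo.wellFiltered S hne hdir hS (⋂₀ T)ᶜ
    (isScottOpen_compl.2 (isScottClosed_sInter hTcl)) (fun x hx hx' => hcon ⟨x, hx, hx'⟩)
  obtain ⟨x, hx, hx'⟩ := isScottCompact_iff.1 (hS K hK).1 T hTne hTdir hTcl
    (fun C hC => (hmeet C hC).mono (inter_subset_inter_left _ (sInter_subset_of_mem hK)))
  exact hKT hx hx'

/-- In a complete lattice, every nonempty intersection of compact saturated sets is compact. -/
theorem isScottCompact_sInter {M : Type u} [CompleteLattice M] {S : Set (Set M)}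
    (hne : S.Nonempty) (hS : ∀ K ∈ S, IsScottCompact K ∧ IsUpperSet K) :
    IsScottCompact (⋂₀ S) := by
  have hS' : ∀ K ∈ S, K ∈ {K : Set M | (IsScottCompact K ∧ IsUpperSet K) ∧ ⋂₀ S ⊆ K} :=
    fun K hK => ⟨hS K hK, sInter_subset_of_mem hK⟩
  have h : ⋂₀ S = ⋂₀ {K : Set M | (IsScottCompact K ∧ IsUpperSet K) ∧ ⋂₀ S ⊆ K} :=
    Subset.antisymm (subset_sInter fun K hK => hK.2) (sInter_subset_sInter hS')
  rw [h]
  refine isScottCompact_sInter_of_directed (hne.mono hS') ?_ (fun K hK => hK.1)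
  rintro A ⟨⟨hA, uA⟩, hSA⟩ B ⟨⟨hB, uB⟩, hSB⟩
  exact ⟨A ∩ B, ⟨⟨isScottCompact_inter hA hB uA uB, uA.inter uB⟩, subset_inter hSA hSB⟩,
    inter_subset_left, inter_subset_right⟩

/-- Scott continuous maps, the morphisms of the category of well-filtered dcpos. -/
structure ScottMap (P : Type u) (Q : Type v) [PartialOrder P] [PartialOrder Q] where
  toFun : P → Q
  scottContinuous : ScottContinuous toFun

namespace ScottMap

variable {P : Type u} {Q : Type v} {R : Type w} [PartialOrder P] [PartialOrder Q] [PartialOrder R]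

instance : CoeFun (ScottMap P Q) fun _ => P → Q := ⟨toFun⟩

theorem monotone (f : ScottMap P Q) : Monotone f := f.scottContinuous.monotone

@[ext] theorem ext {f g : ScottMap P Q} (h : ∀ x, f x = g x) : f = g := by
  cases f; cases g; congr; exact funext h

variable (P) in
/-- The identity map. -/
def id : ScottMap P P := ⟨_root_.id, ScottContinuous.id⟩

/-- The composite `g ∘ f`. -/
def comp (g : ScottMap Q R) (f : ScottMap P Q) : ScottMap P R :=
  ⟨g ∘ f, f.scottContinuous.comp g.scottContinuous⟩

/-- Isomorphisms: Scott continuous maps with a Scott continuous two-sided inverse. -/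
def IsIso (f : ScottMap P Q) : Prop :=
  ∃ g : ScottMap Q P, g.comp f = ScottMap.id P ∧ f.comp g = ScottMap.id Q

end ScottMap

/-- The Hoare power construction `H(P)`: all Scott closed subsets, ordered by inclusion. -/
structure Hoare (P : Type u) [PartialOrder P] where
  carrier : Set P
  isScottClosed' : IsScottClosed carrier

namespace Hoare

variable {P : Type u} {Q : Type v} [PartialOrder P] [PartialOrder Q]

instance : SetLike (Hoare P) P where
  coe := carrier
  coe_injective A B h := by cases A; cases B; congr

instance : PartialOrder (Hoare P) := PartialOrder.ofSetLike (Hoare P) P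

theorem isScottClosed (A : Hoare P) : IsScottClosed (A : Set P) := A.isScottClosed'

@[simp] theorem mem_mk {s : Set P} {h : IsScottClosed s} {x : P} :
    x ∈ (⟨s, h⟩ : Hoare P) ↔ x ∈ s := Iff.rfl

theorem le_def {A B : Hoare P} : A ≤ B ↔ ∀ x ∈ A, x ∈ B := Iff.rfl

theorem mem_of_le (A : Hoare P) {x y : P} (h : x ≤ y) (hy : y ∈ A) : x ∈ A :=
  (isScottClosed_iff.1 A.isScottClosed).1 h hy

/-- The Scott closure of a set. -/
def closure (s : Set P) : Hoare P :=
  ⟨@_root_.closure P (Topology.scott P univ) s, @isClosed_closure P (Topology.scott P univ) s⟩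

theorem subset_closure (s : Set P) : s ⊆ closure s :=
  @_root_.subset_closure P (Topology.scott P univ) s

theorem closure_le {s : Set P} {A : Hoare P} : closure s ≤ A ↔ s ⊆ A := by
  let _ : TopologicalSpace P := Topology.scott P univ
  exact ⟨fun h => (subset_closure s).trans h, fun h => closure_minimal h A.isScottClosed⟩

instance : InfSet (Hoare P) where
  sInf S := ⟨⋂₀ ((fun A : Hoare P => (A : Set P)) '' S),
    isScottClosed_sInter (by rintro _ ⟨A, -, rfl⟩; exact A.isScottClosed)⟩

theorem isGLB_sInf (S : Set (Hoare P)) : IsGLB S (sInf S) :=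
  ⟨fun A hA x hx => hx _ ⟨A, hA, rfl⟩, fun B hB x hx => by
    rintro _ ⟨A, hA, rfl⟩
    exact hB hA hx⟩

instance : CompleteLattice (Hoare P) :=
  { completeLatticeOfInf (Hoare P) isGLB_sInf with
    toPartialOrder := inferInstance }

/-- The unit `η`, sending `x` to its principal ideal. -/
def unit (P : Type u) [PartialOrder P] : ScottMap P (Hoare P) where
  toFun x := ⟨Iic x, isScottClosed_Iic x⟩
  scottContinuous d hne hdir a ha := by
    refine ⟨?_, fun B hB y hy => ?_⟩
    · rintro _ ⟨x, hx, rfl⟩ y hy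
      exact le_trans hy (ha.1 hx)
    · refine B.mem_of_le hy ((isScottClosed_iff.1 B.isScottClosed).2 (fun x hx => ?_) hne hdir ha)
      exact hB ⟨x, hx, rfl⟩ (le_refl x)

theorem isScottClosed_biUnion (𝒜 : Hoare (Hoare P)) :
    IsScottClosed {x : P | ∃ A ∈ 𝒜, x ∈ A} := by
  have h : {x : P | ∃ A ∈ 𝒜, x ∈ A} = unit P ⁻¹' (𝒜 : Set (Hoare P)) := by
    ext x
    exact ⟨fun ⟨A, hA, hx⟩ => 𝒜.mem_of_le (fun y hy => A.mem_of_le hy hx) hA,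
      fun hx => ⟨unit P x, hx, le_refl x⟩⟩
  rw [h]
  exact 𝒜.isScottClosed.preimage (unit P).scottContinuous

/-- The multiplication `μ`, sending a Scott closed set of Scott closed sets to its union. -/
def mult (P : Type u) [PartialOrder P] : ScottMap (Hoare (Hoare P)) (Hoare P) where
  toFun 𝒜 := ⟨{x | ∃ A ∈ 𝒜, x ∈ A}, isScottClosed_biUnion 𝒜⟩
  scottContinuous d _ _ a ha := by
    refine ⟨?_, fun B hB => ?_⟩
    · rintro _ ⟨𝒜, h𝒜, rfl⟩ x ⟨A, hA, hx⟩
      exact ⟨A, ha.1 h𝒜 hA, hx⟩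
    · have h : a ≤ unit (Hoare P) B :=
        ha.2 fun 𝒜 h𝒜 A hA x hx => hB ⟨𝒜, h𝒜, rfl⟩ ⟨A, hA, hx⟩
      rintro x ⟨A, hA, hx⟩
      exact h hA hx

/-- The action of `H` on morphisms: `A ↦ cl (f(A))`. -/
def map (f : ScottMap P Q) : ScottMap (Hoare P) (Hoare Q) where
  toFun A := closure (f '' A)
  scottContinuous d _ _ a ha := by
    refine ⟨?_, fun B hB => ?_⟩
    · rintro _ ⟨A, hA, rfl⟩
      exact closure_le.2 ((image_mono (ha.1 hA)).trans (subset_closure _))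
    · have h : a ≤ ⟨f ⁻¹' B, B.isScottClosed.preimage f.scottContinuous⟩ :=
        ha.2 fun A hA x hx => hB ⟨A, hA, rfl⟩ (subset_closure _ ⟨x, hx, rfl⟩)
      exact closure_le.2 (image_subset_iff.2 h)

end Hoare

/-- The Smyth power construction `Q(P)`: all nonempty Scott compact saturated subsets, ordered by
reverse inclusion. -/
structure Smyth (P : Type u) [PartialOrder P] where
  carrier : Set P
  nonempty' : carrier.Nonempty
  isScottCompact' : IsScottCompact carrier
  isUpperSet' : IsUpperSet carrier

namespace Smyth

variable {P : Type u} {Q : Type v} [PartialOrder P] [PartialOrder Q]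

instance : SetLike (Smyth P) P where
  coe := carrier
  coe_injective A B h := by cases A; cases B; congr

instance : PartialOrder (Smyth P) where
  le K K' := (K' : Set P) ⊆ K
  le_refl _ := Subset.rfl
  le_trans _ _ _ h h' := h'.trans h
  le_antisymm _ _ h h' := SetLike.coe_injective (Subset.antisymm h' h)

theorem le_def {K K' : Smyth P} : K ≤ K' ↔ (K' : Set P) ⊆ K := Iff.rfl

@[simp] theorem mem_mk {s : Set P} {h₁ : s.Nonempty} {h₂ : IsScottCompact s} {h₃ : IsUpperSet s}
    {x : P} : x ∈ (⟨s, h₁, h₂, h₃⟩ : Smyth P) ↔ x ∈ s := Iff.rfl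

theorem nonempty (K : Smyth P) : (K : Set P).Nonempty := K.nonempty'

theorem isScottCompact (K : Smyth P) : IsScottCompact (K : Set P) := K.isScottCompact'

theorem isUpperSet (K : Smyth P) : IsUpperSet (K : Set P) := K.isUpperSet'

section Directed

theorem directedOn_coe {D : Set (Smyth P)} (hdir : DirectedOn (· ≤ ·) D) :
    DirectedOn (· ⊇ ·) ((fun K : Smyth P => (K : Set P)) '' D) := by
  rintro _ ⟨A, hA, rfl⟩ _ ⟨B, hB, rfl⟩
  obtain ⟨E, hE, h1, h2⟩ := hdir A hA B hB
  exact ⟨_, ⟨E, hE, rfl⟩, h1, h2⟩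

theorem isUpperSet_biUnion (𝒦 : Set (Smyth P)) : IsUpperSet {x : P | ∃ K ∈ 𝒦, x ∈ K} :=
  fun _ _ hxy ⟨K, hK, hx⟩ => ⟨K, hK, K.isUpperSet hxy hx⟩

variable [WellFilteredDcpo P]

/-- Well-filteredness, for a directed subset of `Q(P)` and a closed set. -/
theorem meets_of_directed {D : Set (Smyth P)} (hne : D.Nonempty) (hdir : DirectedOn (· ≤ ·) D)
    {C : Set P} (hC : IsScottClosed C) (hmeet : ∀ K ∈ D, ((K : Set P) ∩ C).Nonempty) :
    ∃ x ∈ C, ∀ K ∈ D, x ∈ K := by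
  by_contra hcon
  push Not at hcon
  obtain ⟨_, ⟨K, hK, rfl⟩, hKC⟩ := WellFilteredDcpo.wellFiltered
    ((fun K : Smyth P => (K : Set P)) '' D) (hne.image _) (directedOn_coe hdir)
    (by rintro _ ⟨K, -, rfl⟩; exact ⟨K.isScottCompact, K.isUpperSet⟩) Cᶜ (isScottOpen_compl.2 hC)
    (fun x hx hxC => by
      obtain ⟨K, hK, hxK⟩ := hcon x hxC
      exact hxK (hx _ ⟨K, hK, rfl⟩))
  obtain ⟨x, hx, hxC⟩ := hmeet K hK
  exact hKC hx hxC

/-- The intersection of a directed subset of `Q(P)`, as an element of `Q(P)`. -/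
def dirInter (D : Set (Smyth P)) (hne : D.Nonempty) (hdir : DirectedOn (· ≤ ·) D) : Smyth P where
  carrier := ⋂₀ ((fun K : Smyth P => (K : Set P)) '' D)
  nonempty' := by
    obtain ⟨x, -, hx⟩ := meets_of_directed hne hdir (C := univ)
      (isScottClosed_iff.2 ⟨isLowerSet_univ, DirSupClosed.univ⟩)
      (fun K _ => by rw [inter_univ]; exact K.nonempty)
    exact ⟨x, by rintro _ ⟨K, hK, rfl⟩; exact hx K hK⟩
  isScottCompact' := isScottCompact_sInter_of_directed (hne.image _) (directedOn_coe hdir)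
    (by rintro _ ⟨K, -, rfl⟩; exact ⟨K.isScottCompact, K.isUpperSet⟩)
  isUpperSet' := isUpperSet_sInter (by rintro _ ⟨K, -, rfl⟩; exact K.isUpperSet)

theorem isLUB_dirInter (D : Set (Smyth P)) (hne : D.Nonempty) (hdir : DirectedOn (· ≤ ·) D) :
    IsLUB D (dirInter D hne hdir) :=
  ⟨fun K hK _ hx => hx _ ⟨K, hK, rfl⟩, fun N hN x hx => by
    rintro _ ⟨K, hK, rfl⟩
    exact hN hK hx⟩

theorem mem_of_isLUB {D : Set (Smyth P)} (hne : D.Nonempty) (hdir : DirectedOn (· ≤ ·) D)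
    {K : Smyth P} (hK : IsLUB D K) {x : P} (hx : ∀ K' ∈ D, x ∈ K') : x ∈ K := by
  rw [hK.unique (isLUB_dirInter D hne hdir)]
  rintro _ ⟨K', hK', rfl⟩
  exact hx K' hK'

/-- For a closed set `C`, the members of `Q(P)` that meet `C` form a Scott closed set. -/
theorem isScottClosed_meets {C : Set P} (hC : IsScottClosed C) :
    IsScottClosed {K : Smyth P | ((K : Set P) ∩ C).Nonempty} := by
  refine isScottClosed_iff.2 ⟨fun K K' h hK => hK.mono (inter_subset_inter_left _ h),
    fun D hD hne hdir K hK => ?_⟩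
  obtain ⟨x, hxC, hx⟩ := meets_of_directed hne hdir hC hD
  exact ⟨x, mem_of_isLUB hne hdir hK hx, hxC⟩

theorem isScottCompact_biUnion {𝒦 : Set (Smyth P)} (h𝒦 : IsScottCompact 𝒦) :
    IsScottCompact {x : P | ∃ K ∈ 𝒦, x ∈ K} := by
  rw [isScottCompact_iff]
  intro S hne hdir hcl hmeet
  obtain ⟨K, hK𝒦, hK⟩ := isScottCompact_iff.1 h𝒦
    ((fun C => {K : Smyth P | ((K : Set P) ∩ C).Nonempty}) '' S) (hne.image _)
    (by
      rintro _ ⟨A, hA, rfl⟩ _ ⟨B, hB, rfl⟩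
      obtain ⟨E, hE, h1, h2⟩ := hdir A hA B hB
      exact ⟨_, ⟨E, hE, rfl⟩, fun K hK => hK.mono (inter_subset_inter_right _ h1),
        fun K hK => hK.mono (inter_subset_inter_right _ h2)⟩)
    (by rintro _ ⟨C, hC, rfl⟩; exact isScottClosed_meets (hcl C hC))
    (by
      rintro _ ⟨C, hC, rfl⟩
      obtain ⟨x, ⟨K, hK, hxK⟩, hxC⟩ := hmeet C hC
      exact ⟨K, hK, x, hxK, hxC⟩)
  obtain ⟨x, hxK, hx⟩ := isScottCompact_iff.1 K.isScottCompact S hne hdir hcl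
    (fun C hC => hK _ ⟨C, hC, rfl⟩)
  exact ⟨x, ⟨K, hK𝒦, hxK⟩, hx⟩

/-- `Q(P)` is a well-filtered dcpo whenever `P` is. -/
instance : WellFilteredDcpo (Smyth P) where
  exists_isLUB D hne hdir := ⟨dirInter D hne hdir, isLUB_dirInter D hne hdir⟩
  wellFiltered S hne hdir hS U hU hSU := by
    by_contra hcon
    push Not at hcon
    obtain ⟨C, hCU, hCcl, hCmeet, hCmin⟩ := exists_minimal_closed (fun K hK => (hS K hK).1)
      (isScottClosed_compl.2 hU) (fun K hK => not_subset.1 (hcon K hK))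
    let F : S → Smyth P := fun 𝒦 =>
      { carrier := {x | ∃ K ∈ (𝒦 : Set (Smyth P)) ∩ C, x ∈ K}
        nonempty' := by
          obtain ⟨K, hK⟩ := hCmeet 𝒦 𝒦.2
          obtain ⟨x, hx⟩ := K.nonempty
          exact ⟨x, K, hK, hx⟩
        isScottCompact' := isScottCompact_biUnion ((hS 𝒦 𝒦.2).1.inter_closed hCcl)
        isUpperSet' := isUpperSet_biUnion _ }
    have hle : ∀ (𝒦 : S) (K : Smyth P), K ∈ (𝒦 : Set (Smyth P)) → K ∈ C → F 𝒦 ≤ K :=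
      fun 𝒦 K hK hKC x hx => ⟨K, ⟨hK, hKC⟩, hx⟩
    have hFC : ∀ 𝒦 : S, F 𝒦 ∈ C := fun 𝒦 => by
      obtain ⟨K, hK, hKC⟩ := hCmeet 𝒦 𝒦.2
      exact (isScottClosed_iff.1 hCcl).1 (hle 𝒦 K hK hKC) hKC
    have hFdir : DirectedOn (· ≤ ·) (range F) := by
      rintro _ ⟨𝒜, rfl⟩ _ ⟨ℬ, rfl⟩
      obtain ⟨ℰ, hℰ, h1, h2⟩ := hdir 𝒜 𝒜.2 ℬ ℬ.2
      exact ⟨_, ⟨⟨ℰ, hℰ⟩, rfl⟩, fun x ⟨K, hK, hx⟩ => ⟨K, ⟨h1 hK.1, hK.2⟩, hx⟩,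
        fun x ⟨K, hK, hx⟩ => ⟨K, ⟨h2 hK.1, hK.2⟩, hx⟩⟩
    have hFne : (range F).Nonempty := by
      obtain ⟨𝒦, h𝒦⟩ := hne
      exact ⟨_, ⟨⟨𝒦, h𝒦⟩, rfl⟩⟩
    let K₀ := dirInter (range F) hFne hFdir
    have hK₀ : IsLUB (range F) K₀ := isLUB_dirInter _ _ _
    have hK₀C : K₀ ∈ C := (isScottClosed_iff.1 hCcl).2
      (by rintro _ ⟨𝒦, rfl⟩; exact hFC 𝒦) hFne hFdir hK₀
    have hsub : ∀ x ∈ K₀, ∀ K ∈ C, x ∈ K := by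
      intro x hx K hK
      have hcl : IsScottClosed {K : Smyth P | x ∈ K} := by
        refine isScottClosed_iff.2 ⟨fun A B h hA => h hA, fun D hD hne hdir K hK => ?_⟩
        exact mem_of_isLUB hne hdir hK hD
      refine (hCmin (C ∩ {K : Smyth P | x ∈ K}) inter_subset_left (hCcl.inter hcl)
        (fun 𝒦 h𝒦 => ?_) hK).2
      obtain ⟨K', ⟨h1, h2⟩, h3⟩ := hK₀.1 ⟨⟨𝒦, h𝒦⟩, rfl⟩ hx
      exact ⟨K', h1, h2, h3⟩
    refine hCU hK₀C (hSU fun 𝒦 h𝒦 => ?_)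
    obtain ⟨K, hK, hKC⟩ := hCmeet 𝒦 h𝒦
    exact (hS 𝒦 h𝒦).2 (show K ≤ K₀ from fun x hx => hsub x hx K hKC) hK

end Directed

/-- The unit `θ`, sending `x` to its principal filter. -/
def unit (P : Type u) [PartialOrder P] : ScottMap P (Smyth P) where
  toFun x := ⟨Ici x, ⟨x, le_rfl⟩, isScottCompact_Ici x, isUpperSet_Ici x⟩
  scottContinuous d _ _ a ha := by
    refine ⟨?_, fun K hK y hy => ha.2 fun x hx => hK ⟨x, hx, rfl⟩ hy⟩
    rintro _ ⟨x, hx, rfl⟩ y hy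
    exact le_trans (ha.1 hx) hy

/-- The multiplication `ι`, sending a compact saturated set of compact saturated sets to its
union. -/
def mult (P : Type u) [PartialOrder P] [WellFilteredDcpo P] :
    ScottMap (Smyth (Smyth P)) (Smyth P) where
  toFun 𝒦 :=
    { carrier := {x | ∃ K ∈ 𝒦, x ∈ K}
      nonempty' := by
        obtain ⟨K, hK⟩ := 𝒦.nonempty
        obtain ⟨x, hx⟩ := K.nonempty
        exact ⟨x, K, hK, hx⟩
      isScottCompact' := isScottCompact_biUnion 𝒦.isScottCompact
      isUpperSet' := isUpperSet_biUnion _ }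
  scottContinuous d hne hdir a ha := by
    refine ⟨?_, fun N hN y hy => ?_⟩
    · rintro _ ⟨𝒦, h𝒦, rfl⟩ x ⟨K, hK, hx⟩
      exact ⟨K, ha.1 h𝒦 hK, hx⟩
    · refine ⟨unit P y, mem_of_isLUB hne hdir ha fun 𝒦 h𝒦 => ?_, le_refl y⟩
      obtain ⟨K, hK, hyK⟩ := hN ⟨𝒦, h𝒦, rfl⟩ hy
      exact 𝒦.isUpperSet (show K ≤ unit P y from fun z hz => K.isUpperSet hz hyK) hK

/-- The action of `Q` on morphisms: `K ↦ ↑f(K)`. -/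
def map [WellFilteredDcpo P] (f : ScottMap P Q) : ScottMap (Smyth P) (Smyth Q) where
  toFun K :=
    { carrier := {y | ∃ x ∈ K, f x ≤ y}
      nonempty' := by
        obtain ⟨x, hx⟩ := K.nonempty
        exact ⟨f x, x, hx, le_rfl⟩
      isScottCompact' := K.isScottCompact.upperImage f.scottContinuous
      isUpperSet' := fun _ _ h ⟨x, hx, hxy⟩ => ⟨x, hx, hxy.trans h⟩ }
  scottContinuous d hne hdir a ha := by
    refine ⟨?_, fun N hN y hy => ?_⟩
    · rintro _ ⟨K, hK, rfl⟩ y ⟨x, hx, hxy⟩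
      exact ⟨x, ha.1 hK hx, hxy⟩
    · exact (isScottClosed_iff.1 (isScottClosed_meets
        ((isScottClosed_Iic y).preimage f.scottContinuous))).2
        (fun K hK => hN ⟨K, hK, rfl⟩ hy) hne hdir ha

end Smyth

section DistributiveLaw

variable (L : Type u) [PartialOrder L]

theorem isScottCompact_hoare_meets (K : Smyth L) :
    IsScottCompact {A : Hoare L | ((A : Set L) ∩ K).Nonempty} := by
  have h : {A : Hoare L | ((A : Set L) ∩ K).Nonempty} =
      {A : Hoare L | ∃ x ∈ (K : Set L), Hoare.unit L x ≤ A} := by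
    ext A
    exact ⟨fun ⟨x, hxA, hxK⟩ => ⟨x, hxK, fun y hy => A.mem_of_le hy hxA⟩,
      fun ⟨x, hxK, hx⟩ => ⟨x, hx (le_refl x), hxK⟩⟩
  rw [h]
  exact K.isScottCompact.upperImage (Hoare.unit L).scottContinuous

variable [WellFilteredDcpo L]

/-- The map `φ_L : H(Q(L)) → Q(H(L))`, sending `𝒜` to the set of all Scott closed sets that meet
every member of `𝒜`. -/
def phi : ScottMap (Hoare (Smyth L)) (Smyth (Hoare L)) where
  toFun 𝒜 :=
    { carrier := {A | ∀ K ∈ 𝒜, ((A : Set L) ∩ K).Nonempty}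
      nonempty' := ⟨⟨univ, isScottClosed_iff.2 ⟨isLowerSet_univ, DirSupClosed.univ⟩⟩,
        fun K _ => by
          obtain ⟨x, hx⟩ := K.nonempty
          exact ⟨x, mem_univ x, hx⟩⟩
      isScottCompact' := by
        have h : {A : Hoare L | ∀ K ∈ 𝒜, ((A : Set L) ∩ K).Nonempty} =
            ⋂₀ insert (Ici ⊥) ((fun K : Smyth L => {A : Hoare L | ((A : Set L) ∩ K).Nonempty}) ''
              (𝒜 : Set (Smyth L))) := by
          ext A
          simp
        rw [h]
        refine isScottCompact_sInter (insert_nonempty _ _) ?_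
        rintro _ (rfl | ⟨K, -, rfl⟩)
        · exact ⟨isScottCompact_Ici _, isUpperSet_Ici _⟩
        · exact ⟨isScottCompact_hoare_meets L K,
            fun A B h hA => hA.mono (inter_subset_inter_left _ h)⟩
      isUpperSet' := fun A B h hA K hK => (hA K hK).mono (inter_subset_inter_left _ h) }
  scottContinuous d _ _ a ha := by
    refine ⟨?_, fun 𝒦 h𝒦 A hA => ?_⟩
    · rintro _ ⟨ℬ, hℬ, rfl⟩ A hA K hK
      exact hA K (ha.1 hℬ hK)
    · have h : a ≤ ⟨_, Smyth.isScottClosed_meets A.isScottClosed⟩ := ha.2 fun ℬ hℬ K hK => by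
        have := h𝒦 ⟨ℬ, hℬ, rfl⟩ hA K hK
        rwa [inter_comm] at this
      intro K hK
      rw [inter_comm]
      exact h hK

end DistributiveLaw

section Algebra

/-- The unit `γ_L = θ_{H(L)} ∘ η_L : L → Q(H(L))` of the composite monad `QH`. -/
def qhUnit (L : Type u) [PartialOrder L] : ScottMap L (Smyth (Hoare L)) :=
  (Smyth.unit (Hoare L)).comp (Hoare.unit L)

/-- The multiplication `ρ_L = Q(μ_L) ∘ ι_{H(H(L))} ∘ Q(φ_{H(L)}) : Q(H(Q(H(L)))) → Q(H(L))` of the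
composite monad `QH`. -/
def qhMult (L : Type u) [PartialOrder L] :
    ScottMap (Smyth (Hoare (Smyth (Hoare L)))) (Smyth (Hoare L)) :=
  (Smyth.map (Hoare.mult L)).comp ((Smyth.mult (Hoare (Hoare L))).comp (Smyth.map (phi (Hoare L))))

/-- The action of the composite functor `QH` on morphisms. -/
def qhMap {L : Type u} {M : Type v} [PartialOrder L] [PartialOrder M] (f : ScottMap L M) :
    ScottMap (Smyth (Hoare L)) (Smyth (Hoare M)) :=
  Smyth.map (Hoare.map f)

/-- `(L, α)` is an Eilenberg–Moore algebra of the composite monad `QH`. -/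
structure IsQHAlgebra {L : Type u} [PartialOrder L] (α : ScottMap (Smyth (Hoare L)) L) : Prop where
  unit_law : α.comp (qhUnit L) = ScottMap.id L
  assoc : α.comp (qhMult L) = α.comp (qhMap α)

end Algebra

end PowerDomain

namespace PowerDomain

universe u

/-! ### Compact saturated sets with two generators -/

namespace Smyth

variable {P : Type u} [PartialOrder P]

/-! An algebra structure `α` is forced to be `α 𝒦 = ⨅ A ∈ 𝒦, ⨆ A`, an infimum of suprema, and the
associativity law then says that such expressions may be distributed over each other. Suprema come
from the unit law alone: monotonicity of `α` makes `α (↑A)` the least upper bound of `A`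
(`isLUB_apply_unit`), so `L` is a complete lattice. Associativity, tested on families of singleton
type, yields the nontrivial half of the formula, that every lower bound of the suprema of the
members of `𝒦` is below `α 𝒦` (`le_apply`). For the frame law (`le_of_isLUB`), associativity is
tested on the closed set generated by the pairs `↑{↓x, ↓s}`, `s ∈ S`. Applying `α` inside gives
meets first and then a supremum, something below `⨆ s, x ⊓ s`. Multiplying first goes through `phi`,
which produces closed sets meeting every pair: each contains `x` or all of `S`, so its supremum lies
above `x` or above `⨆ S`, and the value is at least `x ⊓ ⨆ S`. -/

/-- The compact saturated set generated by two points. -/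
def pair (x y : P) : Smyth P where
  carrier := Ici x ∪ Ici y
  nonempty' := ⟨x, Or.inl le_rfl⟩
  isScottCompact' := by
    let _ : TopologicalSpace P := Topology.scott P univ
    exact IsCompact.union (isScottCompact_Ici x) (isScottCompact_Ici y)
  isUpperSet' := (isUpperSet_Ici x).union (isUpperSet_Ici y)

theorem pair_le_unit_left (x y : P) : pair x y ≤ unit P x := fun _ h => Or.inl h

theorem pair_le_unit_right (x y : P) : pair x y ≤ unit P y := fun _ h => Or.inr h

end Smyth

/-! ### Order structure of an algebra -/

namespace IsQHAlgebra

variable {L : Type u} [inst : PartialOrder L] {α : ScottMap (Smyth (Hoare L)) L}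

theorem apply_qhUnit (hα : IsQHAlgebra α) (x : L) : α (qhUnit L x) = x :=
  congrArg (fun f : ScottMap L L => f x) hα.unit_law

theorem apply_qhMult (hα : IsQHAlgebra α) (𝒳 : Smyth (Hoare (Smyth (Hoare L)))) :
    α (qhMult L 𝒳) = α (qhMap α 𝒳) :=
  congrArg (fun f : ScottMap (Smyth (Hoare (Smyth (Hoare L)))) L => f 𝒳) hα.assoc

/-- On principal filters, the structure map of an algebra computes suprema. -/
theorem isLUB_apply_unit (hα : IsQHAlgebra α) (A : Hoare L) :
    IsLUB (A : Set L) (α (Smyth.unit (Hoare L) A)) := by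
  -- Membership `x ∈ A` means `↓x ⊆ A`, and `b` bounds `A` exactly when `A ⊆ ↓b`. The unit law
  -- evaluates `α` at both principal ideals, so monotonicity gives both halves.
  refine ⟨fun x hx => ?_, fun b hb => ?_⟩
  · rw [← hα.apply_qhUnit x]
    exact α.monotone ((Smyth.unit (Hoare L)).monotone fun y hy => A.mem_of_le hy hx)
  · rw [← hα.apply_qhUnit b]
    exact α.monotone ((Smyth.unit (Hoare L)).monotone fun y hy => hb hy)

/-- Each `↓b` is Scott closed, so a set and its closure have the same upper bounds. This provides
suprema of arbitrary subsets, hence completeness. -/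
theorem isLUB_apply_unit_closure (hα : IsQHAlgebra α) (S : Set L) :
    IsLUB S (α (Smyth.unit (Hoare L) (Hoare.closure S))) := by
  have h := hα.isLUB_apply_unit (Hoare.closure S)
  refine ⟨fun x hx => h.1 (Hoare.subset_closure S hx), fun b hb => h.2 ?_⟩
  exact Hoare.closure_le (A := Hoare.unit L b).2 hb

/-- The structure map sends `𝒦` to a value above every lower bound of the suprema of the members
of `𝒦`. -/
theorem le_apply (hα : IsQHAlgebra α) {𝒦 : Smyth (Hoare L)} {m : L}
    (hm : ∀ A ∈ 𝒦, m ≤ α (Smyth.unit (Hoare L) A)) : m ≤ α 𝒦 := by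
  -- Associativity is tested on the image of `𝒦` under `A ↦ ↓(↑A)`: multiplication gives back at
  -- least the members of `𝒦`, while `α` acting inside replaces each `A` by its supremum.
  let e := (Hoare.unit (Smyth (Hoare L))).comp (Smyth.unit (Hoare L))
  have h1 : qhMult L (Smyth.map e 𝒦) ≤ 𝒦 := by
    intro A hA
    -- Every `K` in `↓(↑A)` contains `A`, so `↓A` meets them all, with `A` itself as common point;
    -- the union of `↓A` is `A`.
    refine ⟨Hoare.unit (Hoare L) A, ⟨phi (Hoare L) (e A), ⟨e A, ⟨A, hA, le_rfl⟩, le_rfl⟩, ?_⟩, ?_⟩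
    · exact fun K hK => ⟨A, le_refl A, hK (le_refl A)⟩
    · rintro x ⟨B, hB, hx⟩
      exact hB hx
  -- In reverse inclusion this says that each member of the right side contains `↓m`; it contains
  -- the supremum of some `A ∈ 𝒦`, which is above `m`.
  have h2 : qhUnit L m ≤ qhMap α (Smyth.map e 𝒦) := by
    rintro Y ⟨𝒴, ⟨A, hA, hA𝒴⟩, hY⟩
    have hmem : α (Smyth.unit (Hoare L) A) ∈ Y :=
      hY (Hoare.subset_closure _ ⟨_, hA𝒴 (le_refl (Smyth.unit (Hoare L) A)), rfl⟩)
    exact fun y hy => Y.mem_of_le (le_trans hy (hm A hA)) hmem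
  calc m = α (qhUnit L m) := (hα.apply_qhUnit m).symm
    _ ≤ α (qhMap α (Smyth.map e 𝒦)) := α.monotone h2
    _ = α (qhMult L (Smyth.map e 𝒦)) := (hα.apply_qhMult _).symm
    _ ≤ α 𝒦 := α.monotone h1

/-- The frame law, in terms of bounds. -/
theorem le_of_isLUB (hα : IsQHAlgebra α) {S : Set L} {x t m b : L} (ht : IsLUB S t)
    (hmx : m ≤ x) (hmt : m ≤ t) (hb : ∀ s ∈ S, ∀ c, c ≤ x → c ≤ s → c ≤ b) : m ≤ b := by
  -- The pair `↑{↓x, ↓s}` encodes a meet: `α` sends it to a common lower bound of `x` and `s`, which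
  -- is all that `hb` needs.
  let pr : L → Smyth (Hoare L) := fun s => Smyth.pair (Hoare.unit L x) (Hoare.unit L s)
  let 𝒳 := Smyth.unit (Hoare (Smyth (Hoare L))) (Hoare.closure (pr '' S))
  have h1 : m ≤ α (qhMult L 𝒳) := by
    refine hα.le_apply ?_
    rintro A ⟨𝒞, ⟨Φ, ⟨𝒴, h𝒴, hΦ⟩, h𝒞⟩, hA⟩
    -- Here `𝒞` meets each pair, so some `B ∈ 𝒞` contains `↓x` or `↓s`, and `A` contains the union
    -- of `𝒞`.
    have hmeet : ∀ s ∈ S, x ∈ A ∨ s ∈ A := fun s hs => by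
      obtain ⟨B, hB, hB'⟩ := hΦ h𝒞 (pr s) (h𝒴 (Hoare.subset_closure _ ⟨s, hs, rfl⟩))
      exact hB'.imp (fun h => hA ⟨B, hB, h (le_refl x)⟩) (fun h => hA ⟨B, hB, h (le_refl s)⟩)
    have hlub := hα.isLUB_apply_unit A
    -- As `x` does not depend on `s`, the alternatives collapse to two: `x ∈ A`, or `S ⊆ A`.
    by_cases hx : x ∈ A
    · exact hmx.trans (hlub.1 hx)
    · exact hmt.trans (ht.2 fun s hs => hlub.1 ((hmeet s hs).resolve_left hx))
  have h2 : qhMap α 𝒳 ≤ qhUnit L b := by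
    intro Y hY
    refine ⟨Hoare.closure (pr '' S), mem_Ici.2 le_rfl, le_trans (Hoare.closure_le.2 ?_) hY⟩
    -- The preimage of `↓b` under `α` is Scott closed, so the bound need only be checked on the
    -- generating pairs.
    refine image_subset_iff.2 (Hoare.closure_le
      (A := ⟨α ⁻¹' Iic b, (isScottClosed_Iic b).preimage α.scottContinuous⟩).2 ?_)
    rintro _ ⟨s, hs, rfl⟩
    refine hb s hs _ ?_ ?_
    · exact (α.monotone (Smyth.pair_le_unit_left _ _)).trans (hα.apply_qhUnit x).le
    · exact (α.monotone (Smyth.pair_le_unit_right _ _)).trans (hα.apply_qhUnit s).le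
  calc m ≤ α (qhMult L 𝒳) := h1
    _ = α (qhMap α 𝒳) := hα.apply_qhMult 𝒳
    _ ≤ α (qhUnit L b) := α.monotone h2
    _ = b := hα.apply_qhUnit b

/-- The underlying poset of every `QH`-algebra is a frame. -/
theorem exists_frame (hα : IsQHAlgebra α) : ∃ F : Order.Frame L, F.toPartialOrder = inst := by
  -- Only the supremum operation is read off from `α`; the order remains the given one, so the final
  -- equality of orders is definitional.
  let _ : SupSet L := ⟨fun S => α (Smyth.unit (Hoare L) (Hoare.closure S))⟩
  let C : CompleteLattice L := completeLatticeOfSup L hα.isLUB_apply_unit_closure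
  let F : Order.Frame.MinimalAxioms L :=
    { C with
      inf_sSup_le_iSup_inf := fun x S =>
        -- Used with `m = x ⊓ sSup S` and `b = ⨆ s ∈ S, x ⊓ s`.
        hα.le_of_isLUB (hα.isLUB_apply_unit_closure S) (inf_le_left (α := L)) inf_le_right
          fun s hs c hcx hcs => (le_inf hcx hcs).trans (le_iSup₂_of_le s hs le_rfl) }
  exact ⟨Order.Frame.ofMinimalAxioms F, rfl⟩

end IsQHAlgebra

end PowerDomain

theorem mainTheorem9 {L : Type*} [inst : PartialOrder L] [PowerDomain.WellFilteredDcpo L]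
    (hφ : (PowerDomain.phi L).IsIso)
    (α : PowerDomain.ScottMap (PowerDomain.Smyth (PowerDomain.Hoare L)) L)
    (hα : PowerDomain.IsQHAlgebra α) :
    ∃ F : Order.Frame L, F.toPartialOrder = inst :=
  hα.exists_frame
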